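/- **Setting.** Let $n,d\ge 1$ and let $l_1,u_1,\dots,l_d,u_d:[n-1]\to\mathbb R$ be a bounding family, i.e. $l_i(t)<u_i(t)$ for all $i,t$. Let $\mathcal P$ be the set of all $h:[n]^d\to\mathbb R$ with $l_i(x_i)\le h(x+e_i)-h(x)\le u_i(x_i)$ for all $i$ and all $x$ with $x_i<n$. Put $w_i=(u_i-l_i)/2$ and let $C$ satisfy $w_i(s)/w_i(t)\le C$ for all $i\in[d]$ and $s,t\in[n-1]$. For $f:[n]^d\to\mathbb R$ let $$g(x)=f(x)+\sum_{i=1}^d\sum_{v=x_i}^{n-1}\frac{u_i(v)+l_i(v)}2 ,$$ assume that $g$ takes values in $[a,b]$, $a<b$, and put $r=b-a$. (If the bounds are symmetric, $l_i=-u_i$, then $g=f$ and $w_i=u_i$, so this just says $f:[n]^d\to[a,b]$.) For $\varepsilon\in(0,1)$, $f$ is $\varepsilon$-far from $\mathcal P$ if $\frac1{r\,n^d}\sum_x|f(x)-h(x)|>\varepsilon$ for every $h\in\mathcal P$. **Line tester** for a function $\phi:[n]\to\mathbb R$ with bounds $l,u:[n-1]\to\mathbb R$, $w=(u-l)/2$.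 Let $\mathfrak m(x,y)=\sum_{t=y}^{x-1}u(t)$ if $x\ge y$ and $\mathfrak m(x,y)=-\sum_{t=x}^{y-1}l(t)$ if $x<y$. Query a uniformly random pair $x<y$ among those with $y-x\le r/\min_t w(t)$, and reject iff $\max\{\phi(x)-\phi(y)-\mathfrak m(x,y),\ \phi(y)-\phi(x)-\mathfrak m(y,x)\}>0$. (If there is no such pair, accept.) **Hypergrid tester with $T$ repetitions.** Independently $T$ times, pick a uniformly random axis-parallel line $\ell$ of $[n]^d$, in direction $i$ say, and run the line tester on $f|_\ell$ with the bounds $l_i,u_i$. Reject iff one of the runs rejects. **Lemma.** There is an absolute constant $K>0$ such that, for all data as above, if $f$ is $\varepsilon$-far from $\mathcal P$, then the hypergrid tester with $T=\lceil K\,C\,d/\varepsilon\rceil$ repetitions (so $T=O(d/\varepsilon)$ for bounded $C$) rejects $f$ with probability at least $2/3$. -/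

import Mathlib

noncomputable section

/-- The hypergrid `[n]^d` with `n = m + 1`; the coordinate values `1, …, n` are `Fin (m + 1)`, and the
edges `(t, t + 1)` of the path `[n]` are indexed by `t : Fin m`, joining `t.castSucc` to `t.succ`. -/
abbrev Hypergrid (m d : ℕ) : Type := Fin d → Fin (m + 1)

/-- `l, u` form a bounding family: `l_i(t) < u_i(t)` for every direction `i` and every edge `t`. -/
def IsBoundingFamily {m d : ℕ} (l u : Fin d → Fin m → ℝ) : Prop :=
  ∀ i t, l i t < u i t

/-- The property `P(B)`: `l_i(x_i) ≤ f(x + e_i) - f(x) ≤ u_i(x_i)` for all `i` and all `x` with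
`x_i < n`. In the code `x` has coordinate `t.castSucc` and `x + e_i` has coordinate `t.succ`. -/
def DerivativeBounded {m d : ℕ} (l u : Fin d → Fin m → ℝ) : Set (Hypergrid m d → ℝ) :=
  {f | ∀ (i : Fin d) (x : Hypergrid m d) (t : Fin m), x i = t.castSucc →
    l i t ≤ f (Function.update x i t.succ) - f x ∧
      f (Function.update x i t.succ) - f x ≤ u i t}

/-- The normalized `L₁`-distance `(1 / r) 𝔼|f - h|` under the uniform distribution on `[n]^d`. -/
def l1Dist {m d : ℕ} (r : ℝ) (f h : Hypergrid m d → ℝ) : ℝ :=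
  (1 / r) * ((∑ x, |f x - h x|) / (Fintype.card (Hypergrid m d) : ℝ))

/-- `f` is `ε`-far from the property `P`: its distance to every member of `P` exceeds `ε`. -/
def IsFar {m d : ℕ} (r ε : ℝ) (f : Hypergrid m d → ℝ) (P : Set (Hypergrid m d → ℝ)) : Prop :=
  ∀ h ∈ P, ε < l1Dist r f h

/-- The function `g(x) = f(x) + ∑_i ∑_{v ≥ x_i} (u_i(v) + l_i(v)) / 2`, which turns the bounds
`(l, u)` into the symmetric bounds `(-(u - l) / 2, (u - l) / 2)`. -/
def symmetrize {m d : ℕ} (l u : Fin d → Fin m → ℝ) (f : Hypergrid m d → ℝ) :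
    Hypergrid m d → ℝ :=
  fun x => f x + ∑ i : Fin d, ∑ v : Fin m with x i ≤ v.castSucc, (u i v + l i v) / 2

/-- The upper bound `(u - l) / 2` of the symmetrized bounding functions on a line. -/
def halfWidth {m : ℕ} (l u : Fin m → ℝ) (t : Fin m) : ℝ := (u t - l t) / 2

/-- For symmetric bounds `l = -u` nothing changes: the symmetrized function is `f`. -/
lemma symmetrize_of_symmetric {m d : ℕ} (u : Fin d → Fin m → ℝ) (f : Hypergrid m d → ℝ) :
    symmetrize (-u) u f = f := by
  funext x
  simp [symmetrize]

/-- For symmetric bounds `l = -u` nothing changes: the half-width is `u`. -/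
lemma halfWidth_of_symmetric {m : ℕ} (u : Fin m → ℝ) : halfWidth (-u) u = u := by
  funext t
  simp [halfWidth]

/-- The quasimetric on the line `[n]`: the sum of `u` over the edges from `y` up to `x` if `y < x`,
minus the sum of `l` over the edges from `x` up to `y` if `x < y` (the other sum is empty). -/
def quasimetric {m : ℕ} (l u : Fin m → ℝ) (x y : Fin (m + 1)) : ℝ :=
  (∑ t : Fin m with y ≤ t.castSucc ∧ t.castSucc < x, u t) -
    ∑ t : Fin m with x ≤ t.castSucc ∧ t.castSucc < y, l t

/-- The violation score of the pair `(x, y)`. -/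
def violationScore {m : ℕ} (l u : Fin m → ℝ) (f : Fin (m + 1) → ℝ) (x y : Fin (m + 1)) : ℝ :=
  max (f x - f y - quasimetric l u x y) (f y - f x - quasimetric l u y x)

open scoped Classical in
/-- The pairs `x < y` with `y - x ≤ r / min w`, where `w = (u - l) / 2` (so `w = u` if `l = -u`). -/
def queryPairs {m : ℕ} (r : ℝ) (l u : Fin m → ℝ) : Finset (Fin (m + 1) × Fin (m + 1)) :=
  Finset.univ.filter fun p =>
    p.1 < p.2 ∧ ((p.2 : ℕ) : ℝ) - ((p.1 : ℕ) : ℝ) ≤ r / ⨅ t, halfWidth l u t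

open scoped Classical in
/-- The line tester, as a distribution on its outputs (`true` is "reject"): query a uniformly random
pair from `queryPairs` and reject iff it is violated. With no pair to query it accepts. -/
def lineTester {m : ℕ} (r : ℝ) (l u : Fin m → ℝ) (f : Fin (m + 1) → ℝ) : PMF Bool :=
  if h : (queryPairs r l u).Nonempty then
    (PMF.uniformOfFinset (queryPairs r l u) h).map fun p =>
      decide (0 < violationScore l u f p.1 p.2)
  else PMF.pure false

/-- The axis-parallel lines of `[n]^d`: a direction and the values of all other coordinates. -/
abbrev AxisLine (m d : ℕ) : Type := (i : Fin d) × ({j : Fin d // j ≠ i} → Fin (m + 1))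

instance AxisLine.instNonempty (m d : ℕ) [NeZero d] : Nonempty (AxisLine m d) :=
  ⟨⟨0, fun _ => 0⟩⟩

/-- The point of the line `ℓ` whose coordinate in the direction of `ℓ` is `t`. -/
def AxisLine.point {m d : ℕ} (ℓ : AxisLine m d) (t : Fin (m + 1)) : Hypergrid m d :=
  fun j => if h : j = ℓ.1 then t else ℓ.2 ⟨j, h⟩

/-- `T` independent repetitions of a test, rejecting iff one of them rejects. -/
def repeatTest (p : PMF Bool) : ℕ → PMF Bool
  | 0 => PMF.pure false
  | T + 1 => p.bind fun rejected => if rejected then PMF.pure true else repeatTest p T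

/-- The hypergrid tester with `T` repetitions (`true` is "reject"): each time, pick a uniformly
random axis-parallel line and run the line tester on the restriction of `f` to it. -/
def hypergridTester {m d : ℕ} [NeZero d] (T : ℕ) (r : ℝ) (l u : Fin d → Fin m → ℝ)
    (f : Hypergrid m d → ℝ) : PMF Bool :=
  repeatTest
    ((PMF.uniformOfFintype (AxisLine m d)).bind fun ℓ =>
      lineTester r (l ℓ.1) (u ℓ.1) fun t => f (ℓ.point t))
    T

end

/-! Adding the midpoint tail sums turns the bounds `(l, u)` into `(-w, w)`, so one may work with the
symmetrization `g`. It suffices to show that a single run rejecting with probability `p` forces `f`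
within `8 * C * d * p` of the property; then `O(C d / ε)` independent runs suffice.

Dimension reduction (`exists_forall_boundedAlong_near`): averaging along the edges `(t, t + 1)` in
direction `i` is an `L₁`-contraction, fixes functions already bounded along `i`, keeps bounds along
other directions, and strictly lowers the sum of squares unless nothing is violated. A minimizer of
the sum of squares under distance constraints is therefore bounded along `i`, and directions can be
repaired one at a time, for a total of twice the sum of the one-directional distances.

Line case (`exists_near_of_lineTester`): if a pair is violated by a large margin, its two ends
together have many violated partners (`score_mul_le`). Slack proportional to the number of violated
partners then makes a McShane extension possible (`exists_lipschitz_near`), so the distance is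
bounded by the number of violated pairs. Since `g` has range at most `r`, all of these are among the
pairs that the tester samples. -/

noncomputable section

/-! ### Soft thresholding and the averaging of two values. -/

/-- The part of `s` that exceeds the interval `[-w, w]`. -/
def excess (w s : ℝ) : ℝ := max (s - w) 0 - max (-s - w) 0

lemma excess_neg (w s : ℝ) : excess w (-s) = -excess w s := by
  simp [excess]

lemma excess_eq_zero {w s : ℝ} (h : |s| ≤ w) : excess w s = 0 := by
  obtain ⟨h1, h2⟩ := abs_le.1 h
  rw [excess, max_eq_right (by linarith), max_eq_right (by linarith), sub_zero]

lemma excess_sub_mem {w s s' : ℝ} (hw : 0 ≤ w) (h : s' ≤ s) :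
    0 ≤ excess w s - excess w s' ∧ excess w s - excess w s' ≤ s - s' := by
  unfold excess
  rcases max_cases (s - w) 0 with ⟨h1, h1'⟩ | ⟨h1, h1'⟩ <;>
  rcases max_cases (-s - w) 0 with ⟨h2, h2'⟩ | ⟨h2, h2'⟩ <;>
  rcases max_cases (s' - w) 0 with ⟨h3, h3'⟩ | ⟨h3, h3'⟩ <;>
  rcases max_cases (-s' - w) 0 with ⟨h4, h4'⟩ | ⟨h4, h4'⟩ <;>
  rw [h1, h2, h3, h4] <;> constructor <;> linarith

/-- Monotone and 1-Lipschitz. Consequently averaging two values acts on differences `(p - p', q -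
q')` by a doubly stochastic matrix with entries `1 - θ / 2` and `θ / 2`, which yields both the sup
and the `L₁` contraction below. -/
lemma exists_excess_sub_eq {w : ℝ} (hw : 0 ≤ w) (s s' : ℝ) :
    ∃ θ : ℝ, 0 ≤ θ ∧ θ ≤ 1 ∧ excess w s - excess w s' = θ * (s - s') := by
  rcases eq_or_ne s s' with rfl | hne
  · exact ⟨0, le_rfl, zero_le_one, by simp⟩
  · refine ⟨(excess w s - excess w s') / (s - s'), ?_, ?_,
      (div_mul_cancel₀ _ (sub_ne_zero.2 hne)).symm⟩
    · rcases lt_or_gt_of_ne hne with h | h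
      · have := excess_sub_mem hw h.le
        exact div_nonneg_of_nonpos (by linarith) (by linarith)
      · have := excess_sub_mem hw h.le
        exact div_nonneg this.1 (by linarith)
    · rcases lt_or_gt_of_ne hne with h | h
      · have := excess_sub_mem hw h.le
        exact (div_le_one_of_neg (by linarith)).2 (by linarith)
      · have := excess_sub_mem hw h.le
        exact (div_le_one (by linarith)).2 this.2

lemma abs_averaging_sub_le {w : ℝ} (hw : 0 ≤ w) {p q p' q' c : ℝ}
    (hp : |p - p'| ≤ c) (hq : |q - q'| ≤ c) :
    |(p + excess w (q - p) / 2) - (p' + excess w (q' - p') / 2)| ≤ c := by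
  obtain ⟨θ, h0, h1, h⟩ := exists_excess_sub_eq hw (q - p) (q' - p')
  have : (p + excess w (q - p) / 2) - (p' + excess w (q' - p') / 2)
      = (1 - θ / 2) * (p - p') + θ / 2 * (q - q') := by linear_combination h / 2
  rw [this]
  calc _ ≤ |(1 - θ / 2) * (p - p')| + |θ / 2 * (q - q')| := abs_add_le _ _
    _ = (1 - θ / 2) * |p - p'| + θ / 2 * |q - q'| := by
        rw [abs_mul, abs_mul, abs_of_nonneg (by linarith : 0 ≤ 1 - θ / 2),
          abs_of_nonneg (by linarith : 0 ≤ θ / 2)]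
    _ ≤ (1 - θ / 2) * c + θ / 2 * c := by
        gcongr
        linarith
    _ = c := by ring

lemma abs_averaging_sub_add_le {w : ℝ} (hw : 0 ≤ w) (p q p' q' : ℝ) :
    |(p + excess w (q - p) / 2) - (p' + excess w (q' - p') / 2)| +
      |(q + excess w (p - q) / 2) - (q' + excess w (p' - q') / 2)| ≤ |p - p'| + |q - q'| := by
  obtain ⟨θ, h0, h1, h⟩ := exists_excess_sub_eq hw (q - p) (q' - p')
  have e1 : excess w (p - q) = -excess w (q - p) := by rw [← excess_neg, neg_sub]
  have e2 : excess w (p' - q') = -excess w (q' - p') := by rw [← excess_neg, neg_sub]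
  have h2 : (p + excess w (q - p) / 2) - (p' + excess w (q' - p') / 2)
      = (1 - θ / 2) * (p - p') + θ / 2 * (q - q') := by linear_combination h / 2
  have h3 : (q + excess w (p - q) / 2) - (q' + excess w (p' - q') / 2)
      = θ / 2 * (p - p') + (1 - θ / 2) * (q - q') := by
    rw [e1, e2]; linear_combination -h / 2
  rw [h2, h3]
  have a1 := abs_add_le ((1 - θ / 2) * (p - p')) (θ / 2 * (q - q'))
  have a2 := abs_add_le (θ / 2 * (p - p')) ((1 - θ / 2) * (q - q'))
  rw [abs_mul, abs_mul, abs_of_nonneg (by linarith : 0 ≤ 1 - θ / 2),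
    abs_of_nonneg (by linarith : 0 ≤ θ / 2)] at a1 a2
  linarith

/-- With `e = excess w (q - p)`, the squares change by exactly `e ^ 2 / 2 - e * (q - p)`, and `e`
lies between `0` and `q - p`. -/
lemma averaging_sq_add_le {w : ℝ} (hw : 0 ≤ w) (p q : ℝ) :
    (p + excess w (q - p) / 2) ^ 2 + (q + excess w (p - q) / 2) ^ 2 +
      excess w (q - p) ^ 2 / 2 ≤ p ^ 2 + q ^ 2 := by
  have e1 : excess w (p - q) = -excess w (q - p) := by rw [← excess_neg, neg_sub]
  rw [e1]
  suffices h : excess w (q - p) ^ 2 ≤ excess w (q - p) * (q - p) by nlinarith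
  obtain ⟨θ, h0, h1, h⟩ := exists_excess_sub_eq hw (q - p) 0
  rw [excess_eq_zero (s := 0) (by simpa using hw), sub_zero, sub_zero] at h
  rw [h]
  nlinarith [mul_nonneg (mul_nonneg h0 (sub_nonneg.2 h1)) (sq_nonneg (q - p))]

lemma abs_le_of_excess_eq_zero {w s : ℝ} (hw : 0 ≤ w) (h : excess w s = 0) : |s| ≤ w := by
  unfold excess at h
  rw [abs_le]
  rcases max_cases (s - w) 0 with ⟨h1, h1'⟩ | ⟨h1, h1'⟩ <;>
  rcases max_cases (-s - w) 0 with ⟨h2, h2'⟩ | ⟨h2, h2'⟩ <;>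
  rw [h1, h2] at h <;> constructor <;> linarith

/-! ### Edge averaging on the hypergrid and dimension reduction. -/

variable {m d : ℕ}

/-- The functions whose increments along direction `i` are bounded by `w` in absolute value. -/
def BoundedAlong (w : Fin m → ℝ) (i : Fin d) : Set (Hypergrid m d → ℝ) :=
  {g | ∀ (x : Hypergrid m d) (t : Fin m), x i = t.castSucc →
    |g (Function.update x i t.succ) - g x| ≤ w t}

/-- The reflection of the hypergrid exchanging the hyperplanes `x i = t` and `x i = t + 1`. -/
def edgeSwap (i : Fin d) (t : Fin m) (x : Hypergrid m d) : Hypergrid m d :=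
  Function.update x i (Equiv.swap t.castSucc t.succ (x i))

lemma edgeSwap_involutive (i : Fin d) (t : Fin m) :
    Function.Involutive (edgeSwap i t : Hypergrid m d → Hypergrid m d) := by
  intro x
  simp [edgeSwap]

lemma sum_edgeSwap (i : Fin d) (t : Fin m) (F : Hypergrid m d → ℝ) :
    ∑ x, F (edgeSwap i t x) = ∑ x, F x :=
  Equiv.sum_comp (edgeSwap_involutive i t).toPerm F

/-- Averaging over all edges `(t, t + 1)` in direction `i`: the values at the ends of each such edge
are moved towards each other just enough for their difference to be at most `w`. -/
def edgeAverage (w : ℝ) (i : Fin d) (t : Fin m) (g : Hypergrid m d → ℝ) : Hypergrid m d → ℝ :=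
  fun x => g x + excess w (g (edgeSwap i t x) - g x) / 2

/-- Summing the two-point inequality over all `x` and its reflection counts everything twice. Points
off the edge layer are fixed by `edgeSwap` and need no separate treatment. -/
lemma sum_abs_edgeAverage_sub_le {w : ℝ} (hw : 0 ≤ w) (i : Fin d) (t : Fin m)
    (g h : Hypergrid m d → ℝ) :
    ∑ x, |edgeAverage w i t g x - edgeAverage w i t h x| ≤ ∑ x, |g x - h x| := by
  have e1 := sum_edgeSwap i t fun x => |edgeAverage w i t g x - edgeAverage w i t h x|
  have e2 := sum_edgeSwap i t fun x => |g x - h x|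
  have key : ∑ x, (|edgeAverage w i t g x - edgeAverage w i t h x| +
      |edgeAverage w i t g (edgeSwap i t x) - edgeAverage w i t h (edgeSwap i t x)|) ≤
      ∑ x, (|g x - h x| + |g (edgeSwap i t x) - h (edgeSwap i t x)|) := by
    refine Finset.sum_le_sum fun x _ => ?_
    simp only [edgeAverage, edgeSwap_involutive i t x]
    exact abs_averaging_sub_add_le hw _ _ _ _
  rw [Finset.sum_add_distrib, Finset.sum_add_distrib] at key
  linarith

lemma sum_sq_edgeAverage_add_le {w : ℝ} (hw : 0 ≤ w) (i : Fin d) (t : Fin m)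
    (g : Hypergrid m d → ℝ) :
    ∑ x, edgeAverage w i t g x ^ 2 + (∑ x, excess w (g (edgeSwap i t x) - g x) ^ 2) / 4 ≤
      ∑ x, g x ^ 2 := by
  have e1 := sum_edgeSwap i t fun x => edgeAverage w i t g x ^ 2
  have e2 := sum_edgeSwap i t fun x => g x ^ 2
  have key : ∑ x, (edgeAverage w i t g x ^ 2 + edgeAverage w i t g (edgeSwap i t x) ^ 2 +
      excess w (g (edgeSwap i t x) - g x) ^ 2 / 2) ≤
      ∑ x, (g x ^ 2 + g (edgeSwap i t x) ^ 2) := by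
    refine Finset.sum_le_sum fun x _ => ?_
    simp only [edgeAverage, edgeSwap_involutive i t x]
    exact averaging_sq_add_le hw _ _
  rw [Finset.sum_add_distrib, Finset.sum_add_distrib, Finset.sum_add_distrib,
    ← Finset.sum_div] at key
  linarith

lemma abs_sub_edgeSwap_le {w : Fin m → ℝ} (hw : ∀ t, 0 ≤ w t) {i : Fin d}
    {h : Hypergrid m d → ℝ} (hh : h ∈ BoundedAlong w i) (t : Fin m) (x : Hypergrid m d) :
    |h (edgeSwap i t x) - h x| ≤ w t := by
  by_cases h1 : x i = t.castSucc
  · have := hh x t h1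
    rwa [edgeSwap, h1, Equiv.swap_apply_left]
  by_cases h2 : x i = t.succ
  · have := hh (edgeSwap i t x) t (by simp [edgeSwap, h2])
    rw [abs_sub_comm]
    convert this using 4
    simp [edgeSwap, ← h2]
  · rw [edgeSwap, Equiv.swap_apply_of_ne_of_ne h1 h2, Function.update_eq_self]
    simpa using hw t

lemma edgeAverage_of_boundedAlong {w : Fin m → ℝ} (hw : ∀ t, 0 ≤ w t) {i : Fin d}
    {h : Hypergrid m d → ℝ} (hh : h ∈ BoundedAlong w i) (t : Fin m) :
    edgeAverage (w t) i t h = h := by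
  funext x
  rw [edgeAverage, excess_eq_zero (abs_sub_edgeSwap_le hw hh t x), zero_div, add_zero]

/-- For `j ≠ i` a step in direction `j` commutes with `edgeSwap i t`, so the averaged increment is a
convex combination of two increments over the same edge in direction `j`. -/
lemma edgeAverage_mem_boundedAlong {w : Fin d → Fin m → ℝ} (hw : ∀ i t, 0 ≤ w i t) (i j : Fin d)
    {h : Hypergrid m d → ℝ} (hh : h ∈ BoundedAlong (w j) j) (t : Fin m) :
    edgeAverage (w i t) i t h ∈ BoundedAlong (w j) j := by
  rcases eq_or_ne j i with rfl | hne
  · rwa [edgeAverage_of_boundedAlong (hw j) hh]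
  · intro x s hx
    refine abs_averaging_sub_le (hw i t) (hh x s hx) ?_
    have e : edgeSwap i t (Function.update x j s.succ) =
        Function.update (edgeSwap i t x) j s.succ := by
      simp only [edgeSwap]
      rw [Function.update_of_ne hne.symm, Function.update_comm hne]
    rw [e]
    exact hh _ s (by simpa [edgeSwap, Function.update_of_ne hne] using hx)

lemma boundedAlong_of_excess_eq_zero {w : Fin m → ℝ} (hw : ∀ t, 0 ≤ w t) {i : Fin d}
    {g : Hypergrid m d → ℝ} (h : ∀ t x, excess (w t) (g (edgeSwap i t x) - g x) = 0) :
    g ∈ BoundedAlong w i := by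
  intro x t hx
  have := abs_le_of_excess_eq_zero (hw t) (h t x)
  rwa [edgeSwap, hx, Equiv.swap_apply_left] at this

lemma isClosed_boundedAlong (w : Fin m → ℝ) (i : Fin d) : IsClosed (BoundedAlong w i) := by
  simp only [BoundedAlong, Set.ofPred_forall]
  refine isClosed_iInter fun x => isClosed_iInter fun t => isClosed_iInter fun _ => ?_
  exact isClosed_le (by fun_prop) continuous_const

/-- Repairing one direction at twice the `L₁`-cost without spoiling the others. -/
lemma exists_boundedAlong_near {w : Fin d → Fin m → ℝ} (hw : ∀ i t, 0 ≤ w i t)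
    (f : Hypergrid m d → ℝ) (h : Fin d → Hypergrid m d → ℝ) (c : Fin d → ℝ)
    (hh : ∀ j, h j ∈ BoundedAlong (w j) j) (hc : ∀ j, ∑ x, |f x - h j x| ≤ c j) (i : Fin d) :
    ∃ (f' : Hypergrid m d → ℝ) (h' : Fin d → Hypergrid m d → ℝ),
      (∀ j, h' j ∈ BoundedAlong (w j) j) ∧ (∀ j, ∑ x, |f' x - h' j x| ≤ c j) ∧
      f' ∈ BoundedAlong (w i) i ∧ ∑ x, |f x - f' x| ≤ 2 * c i := by
  -- The witnesses `h' j` vary together with `f'`, while the last constraint ties `f'` to the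
  -- original `h i`; this gives boundedness of `S` and the final factor `2`.
  let S : Set ((Hypergrid m d → ℝ) × (Fin d → Hypergrid m d → ℝ)) :=
    {p | (∀ j, p.2 j ∈ BoundedAlong (w j) j) ∧ (∀ j, ∑ x, |p.1 x - p.2 j x| ≤ c j) ∧
      ∑ x, |p.1 x - h i x| ≤ c i}
  have hclosed : IsClosed S := by
    refine IsClosed.and ?_ (IsClosed.and ?_ ?_)
    · simp only [Set.ofPred_forall]
      refine isClosed_iInter fun j => (isClosed_boundedAlong (w j) j).preimage ?_
      fun_prop
    · simp only [Set.ofPred_forall]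
      exact isClosed_iInter fun j => isClosed_le (by fun_prop) continuous_const
    · exact isClosed_le (by fun_prop) continuous_const
  have hcompact : IsCompact S := by
    refine IsCompact.of_isClosed_subset (isCompact_Icc
      (a := ((fun x => h i x - c i), fun j x => h i x - c i - c j))
      (b := ((fun x => h i x + c i), fun j x => h i x + c i + c j))) hclosed ?_
    rintro ⟨f', h'⟩ ⟨-, h2, h3⟩
    have a1 : ∀ x, |f' x - h i x| ≤ c i := fun x =>
      (Finset.single_le_sum (f := fun x => |f' x - h i x|) (fun _ _ => abs_nonneg _)
        (Finset.mem_univ x)).trans h3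
    have a2 : ∀ j x, |f' x - h' j x| ≤ c j := fun j x =>
      (Finset.single_le_sum (f := fun x => |f' x - h' j x|) (fun _ _ => abs_nonneg _)
        (Finset.mem_univ x)).trans (h2 j)
    refine ⟨⟨fun x => ?_, fun j x => ?_⟩, ⟨fun x => ?_, fun j x => ?_⟩⟩ <;>
      first
      | (have := abs_le.1 (a1 x); have := abs_le.1 (a2 j x); dsimp only; linarith)
      | (have := abs_le.1 (a1 x); dsimp only; linarith)
  obtain ⟨⟨f', h'⟩, ⟨m1, m2, m3⟩, hmin⟩ := hcompact.exists_isMinOn ⟨(f, h), hh, hc, hc i⟩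
    (f := fun p => ∑ x, p.1 x ^ 2) (by fun_prop)
  refine ⟨f', h', m1, m2, ?_, ?_⟩
  · refine boundedAlong_of_excess_eq_zero (hw i) fun t => ?_
    -- Averaging `f'` and all witnesses simultaneously stays in `S`; minimality of the sum of
    -- squares then forces every excess to vanish.
    have hmem : (edgeAverage (w i t) i t f', fun j => edgeAverage (w i t) i t (h' j)) ∈ S := by
      refine ⟨fun j => edgeAverage_mem_boundedAlong hw i j (m1 j) t,
        fun j => (sum_abs_edgeAverage_sub_le (hw i t) i t _ _).trans (m2 j), ?_⟩
      have := (sum_abs_edgeAverage_sub_le (hw i t) i t f' (h i)).trans m3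
      rwa [edgeAverage_of_boundedAlong (hw i) (hh i)] at this
    have h1 : ∑ x, f' x ^ 2 ≤ ∑ x, edgeAverage (w i t) i t f' x ^ 2 := hmin hmem
    have h2 := sum_sq_edgeAverage_add_le (hw i t) i t f'
    have h3 : ∑ x, excess (w i t) (f' (edgeSwap i t x) - f' x) ^ 2 = 0 :=
      le_antisymm (by linarith) (Finset.sum_nonneg fun _ _ => sq_nonneg _)
    intro x
    exact pow_eq_zero_iff (two_ne_zero) |>.1
      ((Finset.sum_eq_zero_iff_of_nonneg fun _ _ => sq_nonneg _).1 h3 x (Finset.mem_univ x))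
  · calc ∑ x, |f x - f' x| ≤ ∑ x, (|f x - h i x| + |f' x - h i x|) := by
          refine Finset.sum_le_sum fun x _ => ?_
          rw [abs_sub_comm (f' x)]
          exact abs_sub_le _ _ _
      _ ≤ 2 * c i := by
          rw [Finset.sum_add_distrib]
          linarith [hc i]

/-- Dimension reduction: the `L₁`-distance to the functions bounded in all directions is at most
twice the sum of the distances for the single directions. -/
lemma exists_forall_boundedAlong_near {w : Fin d → Fin m → ℝ} (hw : ∀ i t, 0 ≤ w i t)
    (f : Hypergrid m d → ℝ) (h : Fin d → Hypergrid m d → ℝ) (c : Fin d → ℝ)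
    (hh : ∀ j, h j ∈ BoundedAlong (w j) j) (hc : ∀ j, ∑ x, |f x - h j x| ≤ c j) :
    ∃ f' : Hypergrid m d → ℝ, (∀ j, f' ∈ BoundedAlong (w j) j) ∧
      ∑ x, |f x - f' x| ≤ 2 * ∑ j, c j := by
  -- Distance `0` to a witness encodes that `f'` is already bounded along `j`; later repairs keep
  -- that distance at `0`.
  have key : ∀ J : Finset (Fin d),
      ∃ (f' : Hypergrid m d → ℝ) (h' : Fin d → Hypergrid m d → ℝ),
        (∀ j, h' j ∈ BoundedAlong (w j) j) ∧
        (∀ j, ∑ x, |f' x - h' j x| ≤ if j ∈ J then 0 else c j) ∧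
        ∑ x, |f x - f' x| ≤ 2 * ∑ j ∈ J, c j := by
    intro J
    induction J using Finset.induction_on with
    | empty => exact ⟨f, h, hh, by simpa using hc, by simp⟩
    | insert i J hi ih =>
      obtain ⟨f₁, h₁, a1, a2, a3⟩ := ih
      obtain ⟨f₂, h₂, b1, b2, b3, b4⟩ := exists_boundedAlong_near hw f₁ h₁ _ a1 a2 i
      rw [if_neg hi] at b4
      refine ⟨f₂, Function.update h₂ i f₂, fun j => ?_, fun j => ?_, ?_⟩
      · rcases eq_or_ne j i with rfl | hne
        · simpa using b3
        · simpa [Function.update_of_ne hne] using b1 j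
      · rcases eq_or_ne j i with rfl | hne
        · simp
        · simpa [Function.update_of_ne hne, Finset.mem_insert, hne] using b2 j
      · rw [Finset.sum_insert hi]
        calc ∑ x, |f x - f₂ x| ≤ ∑ x, (|f x - f₁ x| + |f₁ x - f₂ x|) :=
              Finset.sum_le_sum fun x _ => abs_sub_le _ _ _
          _ ≤ _ := by
              rw [Finset.sum_add_distrib]
              linarith
  obtain ⟨f', h', a1, a2, a3⟩ := key Finset.univ
  refine ⟨f', fun j => ?_, a3⟩
  have h0 := a2 j
  rw [if_pos (Finset.mem_univ j)] at h0
  have h1 := (Finset.sum_eq_zero_iff_of_nonneg fun _ _ => abs_nonneg _).1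
    (le_antisymm h0 (Finset.sum_nonneg fun _ _ => abs_nonneg _))
  have : f' = h' j := by
    funext x
    exact sub_eq_zero.1 (abs_eq_zero.1 (h1 x (Finset.mem_univ x)))
  rw [this]
  exact a1 j

end

/-! ### Functions on a line: distance to Lipschitz functions and violated pairs. -/

noncomputable section

/-- McShane extension from below of `φ - s`: the maximum over `y` of the cones `φ y - s y - |U x - U
y|`. -/
lemma exists_lipschitz_near {α : Type*} [Fintype α] [Nonempty α] (φ s U : α → ℝ)
    (h : ∀ x y, φ x - φ y ≤ s x + s y + |U x - U y|) :
    ∃ η : α → ℝ, (∀ x y, |η x - η y| ≤ |U x - U y|) ∧ ∀ x, |φ x - η x| ≤ s x := by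
  let F : α → α → ℝ := fun x y => φ y - s y - |U x - U y|
  have hF : ∀ x y, F x y ≤ Finset.univ.sup' Finset.univ_nonempty (F x) := fun x y =>
    Finset.le_sup' (F x) (Finset.mem_univ y)
  have h1 : ∀ x y, Finset.univ.sup' Finset.univ_nonempty (F x) ≤
      Finset.univ.sup' Finset.univ_nonempty (F y) + |U x - U y| := by
    intro x y
    refine Finset.sup'_le _ _ fun z _ => ?_
    have a1 : φ z - s z - |U y - U z| ≤ _ := hF y z
    have a2 := abs_sub_le (U y) (U x) (U z)
    rw [abs_sub_comm (U y) (U x)] at a2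
    change φ z - s z - |U x - U z| ≤ _
    linarith
  refine ⟨fun x => Finset.univ.sup' Finset.univ_nonempty (F x), fun x y => ?_, fun x => ?_⟩
  · rw [abs_le]
    have a1 := h1 x y
    have a2 := h1 y x
    rw [abs_sub_comm] at a2
    constructor <;> linarith
  · have a1 := hF x x
    have a2 : Finset.univ.sup' Finset.univ_nonempty (F x) ≤ φ x + s x := by
      refine Finset.sup'_le _ _ fun z _ => ?_
      have := h z x
      rw [abs_sub_comm] at this
      simp only [F]
      linarith
    simp only [F, sub_self, abs_zero, sub_zero] at a1
    rw [abs_le]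
    constructor <;> simp only [F] at * <;> linarith

variable {m : ℕ}

open scoped Classical in
/-- The points `z` whose pair with `x` violates the Lipschitz condition for the metric `|U x - U z|`. -/
def violatedPartners (φ U : Fin (m + 1) → ℝ) (x : Fin (m + 1)) : Finset (Fin (m + 1)) :=
  Finset.univ.filter fun z => |U x - U z| < |φ x - φ z|

open scoped Classical in
/-- The pairs `x < y` that violate the Lipschitz condition for the metric `|U x - U y|`. -/
def violatedPairs (φ U : Fin (m + 1) → ℝ) : Finset (Fin (m + 1) × Fin (m + 1)) :=
  Finset.univ.filter fun p => p.1 < p.2 ∧ |U p.1 - U p.2| < |φ p.1 - φ p.2|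

lemma sum_card_violatedPartners (φ U : Fin (m + 1) → ℝ) :
    ∑ x, (violatedPartners φ U x).card = 2 * (violatedPairs φ U).card := by
  classical
  have h1 : ∑ x, (violatedPartners φ U x).card =
      ∑ x, ∑ y, ((if x < y ∧ |U x - U y| < |φ x - φ y| then 1 else 0) +
        if y < x ∧ |U y - U x| < |φ y - φ x| then 1 else 0) := by
    refine Finset.sum_congr rfl fun x _ => ?_
    rw [violatedPartners, Finset.card_filter]
    refine Finset.sum_congr rfl fun y _ => ?_
    rw [abs_sub_comm (U y), abs_sub_comm (φ y)]
    rcases lt_trichotomy x y with h | rfl | h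
    · simp [h, h.not_gt]
    · simp
    · simp [h, h.not_gt]
  have h2 : (violatedPairs φ U).card =
      ∑ x, ∑ y, if x < y ∧ |U x - U y| < |φ x - φ y| then 1 else 0 := by
    rw [violatedPairs, Finset.card_filter, Fintype.sum_prod_type]
  simp_rw [Finset.sum_add_distrib] at h1
  rw [h1, h2, Finset.sum_comm (f := fun x y => if y < x ∧ |U y - U x| < |φ y - φ x| then 1 else 0)]
  ring

/-- Both ends of a strongly violated pair together have many violated partners. -/
lemma score_mul_le {φ U : Fin (m + 1) → ℝ} {r C ω μ : ℝ} (hC : 1 ≤ C) (hr : 0 ≤ r) (hμ : 0 < μ)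
    (hμr : μ * ω ≤ r) (hμn : μ ≤ m + 1) (hω : 0 ≤ ω) (hφ : ∀ x y, |φ x - φ y| ≤ r)
    (hU : Monotone U)
    (hUC : ∀ x y : Fin (m + 1), x ≤ y → U y - U x ≤ C * ω * (((y : ℕ) : ℝ) - ((x : ℕ) : ℝ)))
    {x y : Fin (m + 1)} (hxy : x ≤ y) :
    (|φ x - φ y| - |U x - U y|) * μ ≤
      2 * C * r * ((violatedPartners φ U x).card + (violatedPartners φ U y).card) := by
  classical
  by_contra! hcon
  set V := violatedPartners φ U x ∪ violatedPartners φ U y with hV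
  set N := V.card with hN
  have hNle : (N : ℝ) ≤ (violatedPartners φ U x).card + (violatedPartners φ U y).card := by
    exact_mod_cast Finset.card_union_le _ _
  have hCr : 0 ≤ 2 * C * r := by positivity
  have hσ : 2 * C * r * N < (|φ x - φ y| - |U x - U y|) * μ :=
    (mul_le_mul_of_nonneg_left hNle hCr).trans_lt hcon
  have hxyU : |U x - U y| = U y - U x := by
    rw [abs_sub_comm, abs_of_nonneg (sub_nonneg.2 (hU hxy))]
  -- The margin exceeds twice the largest possible `U`-length of `N` edges.
  have hσ1 : 2 * (C * ω * N) < |φ x - φ y| - |U x - U y| := by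
    have : 2 * (C * ω * N) * μ ≤ 2 * C * r * N := by
      have := mul_le_mul_of_nonneg_left hμr (by positivity : 0 ≤ 2 * C * N)
      linarith
    exact lt_of_mul_lt_mul_right (this.trans_lt hσ) hμ.le
  have hNn : N < m + 1 := by
    have h1 : |φ x - φ y| - |U x - U y| ≤ r := by linarith [hφ x y, abs_nonneg (U x - U y)]
    have h2 : 2 * C * r * N < r * μ := hσ.trans_le (mul_le_mul_of_nonneg_right h1 hμ.le)
    have h3 : r * N ≤ 2 * C * r * N := by
      have : 0 ≤ r * N := by positivity
      nlinarith
    have h4 : (N : ℝ) < μ := lt_of_mul_lt_mul_left (h3.trans_lt h2) hr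
    exact_mod_cast h4.trans_le hμn
  -- A `z` violated with neither end would give a path from `x` to `y` through `z` whose `U`-length
  -- exceeds `|U x - U y|` by at most twice an overshoot of `N` edges, contradicting `hσ1`.
  have hmem : ∀ z : Fin (m + 1), (x : ℕ) ≤ z + N → (z : ℕ) ≤ y + N → z ∈ V := by
    intro z hz1 hz2
    by_contra hz
    simp only [hV, violatedPartners, Finset.mem_union, Finset.mem_filter, Finset.mem_univ, true_and,
      not_or, not_lt] at hz
    obtain ⟨h1, h2⟩ := hz
    have h3 := abs_sub_le (φ x) (φ z) (φ y)
    rw [abs_sub_comm (φ z)] at h3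
    have hCω : 0 ≤ C * ω := by positivity
    rw [hxyU] at hσ1
    have h0 : 0 ≤ C * ω * N := by positivity
    rcases le_total z x with hzx | hxz
    · have a1 := hUC z x hzx
      have a2 : C * ω * (((x : ℕ) : ℝ) - ((z : ℕ) : ℝ)) ≤ C * ω * N := by
        refine mul_le_mul_of_nonneg_left ?_ hCω
        rw [sub_le_iff_le_add']
        exact_mod_cast hz1
      rw [abs_of_nonneg (sub_nonneg.2 (hU hzx))] at h1
      rw [abs_of_nonneg (sub_nonneg.2 (hU (hzx.trans hxy)))] at h2
      linarith
    · rw [abs_sub_comm, abs_sub_comm (U x), abs_of_nonneg (sub_nonneg.2 (hU hxz))] at h1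
      rw [abs_sub_comm (φ z)] at h1
      rcases le_total z y with hzy | hyz
      · rw [abs_sub_comm (U y), abs_sub_comm, abs_sub_comm (U z),
          abs_of_nonneg (sub_nonneg.2 (hU hzy))] at h2
        rw [abs_sub_comm (φ z)] at h2
        linarith
      · have a1 := hUC y z hyz
        have a2 : C * ω * (((z : ℕ) : ℝ) - ((y : ℕ) : ℝ)) ≤ C * ω * N := by
          refine mul_le_mul_of_nonneg_left ?_ hCω
          rw [sub_le_iff_le_add']
          exact_mod_cast hz2
        rw [abs_sub_comm (U y), abs_of_nonneg (sub_nonneg.2 (hU hyz))] at h2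
        linarith
  have hxy' : (x : ℕ) ≤ y := hxy
  have hx := x.isLt
  have hy := y.isLt
  -- `V` has only `N` elements, yet it contains `N + 1` points above `y` or below `x`, or, when
  -- neither interval fits, the whole line, although `N < m + 1`.
  by_cases hc1 : (y : ℕ) + N < m + 1
  · have hsub : Finset.Icc y ⟨y + N, hc1⟩ ⊆ V := fun z hz => by
      rw [Finset.mem_Icc, Fin.le_def, Fin.le_def] at hz
      exact hmem z (by omega) hz.2
    have := Finset.card_le_card hsub
    rw [Fin.card_Icc] at this
    dsimp only at this
    omega
  by_cases hc2 : N ≤ (x : ℕ)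
  · have hsub : Finset.Icc ⟨x - N, by omega⟩ x ⊆ V := fun z hz => by
      rw [Finset.mem_Icc, Fin.le_def, Fin.le_def] at hz
      dsimp only at hz
      exact hmem z (by omega) (by omega)
    have := Finset.card_le_card hsub
    rw [Fin.card_Icc] at this
    dsimp only at this
    omega
  · have hsub : Finset.univ ⊆ V := fun z _ => by
      have := z.isLt
      exact hmem z (by omega) (by omega)
    have := Finset.card_le_card hsub
    rw [Finset.card_univ, Fintype.card_fin] at this
    omega

/-- The `L₁`-distance of a line function to the Lipschitz functions is bounded by the number of its
violated pairs. -/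
lemma exists_lipschitz_near_of_violatedPairs {φ U : Fin (m + 1) → ℝ} {r C ω μ : ℝ} (hC : 1 ≤ C)
    (hr : 0 ≤ r) (hμ : 0 < μ) (hμr : μ * ω ≤ r) (hμn : μ ≤ m + 1) (hω : 0 ≤ ω)
    (hφ : ∀ x y, |φ x - φ y| ≤ r) (hU : Monotone U)
    (hUC : ∀ x y : Fin (m + 1), x ≤ y → U y - U x ≤ C * ω * (((y : ℕ) : ℝ) - ((x : ℕ) : ℝ))) :
    ∃ η : Fin (m + 1) → ℝ, (∀ x y, |η x - η y| ≤ |U x - U y|) ∧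
      ∑ x, |φ x - η x| ≤ 4 * C * r / μ * (violatedPairs φ U).card := by
  obtain ⟨η, h1, h2⟩ := exists_lipschitz_near φ
    (fun x => 2 * C * r / μ * (violatedPartners φ U x).card) U fun x y => by
      have key : (|φ x - φ y| - |U x - U y|) * μ ≤
          2 * C * r * ((violatedPartners φ U x).card + (violatedPartners φ U y).card) := by
        rcases le_total x y with h | h
        · exact score_mul_le hC hr hμ hμr hμn hω hφ hU hUC h
        · rw [abs_sub_comm, abs_sub_comm (U x), add_comm]
          exact score_mul_le hC hr hμ hμr hμn hω hφ hU hUC h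
      rw [← le_div_iff₀ hμ] at key
      have e : 2 * C * r * ((violatedPartners φ U x).card + (violatedPartners φ U y).card : ℝ) / μ =
        2 * C * r / μ * (violatedPartners φ U x).card +
          2 * C * r / μ * (violatedPartners φ U y).card := by ring
      linarith [le_abs_self (φ x - φ y)]
  refine ⟨η, h1, (Finset.sum_le_sum fun x _ => h2 x).trans_eq ?_⟩
  rw [← Finset.mul_sum, ← Nat.cast_sum, sum_card_violatedPartners]
  push_cast
  ring

/-! ### Tail sums, the violation score and the line tester. -/

/-- The sum of `F` over the edges of the path above the vertex `x`. -/
def tailSum (F : Fin m → ℝ) (x : Fin (m + 1)) : ℝ := ∑ v : Fin m with x ≤ v.castSucc, F v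

lemma tailSum_sub_tailSum (F : Fin m → ℝ) {x y : Fin (m + 1)} (h : x ≤ y) :
    tailSum F x - tailSum F y = ∑ v : Fin m with x ≤ v.castSucc ∧ v.castSucc < y, F v := by
  rw [tailSum, tailSum, sub_eq_iff_eq_add]
  simp only [Finset.sum_filter, ← Finset.sum_add_distrib]
  refine Finset.sum_congr rfl fun v _ => ?_
  by_cases h1 : y ≤ v.castSucc
  · simp [h1, h1.not_gt, h.trans h1]
  · simp [h1, not_le.1 h1]

lemma tailSum_castSucc_sub_tailSum_succ (F : Fin m → ℝ) (t : Fin m) :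
    tailSum F t.castSucc - tailSum F t.succ = F t := by
  rw [tailSum_sub_tailSum F (Fin.castSucc_lt_succ).le]
  have : (Finset.univ.filter fun v : Fin m => t.castSucc ≤ v.castSucc ∧ v.castSucc < t.succ) =
      {t} := by
    ext v
    simp only [Finset.mem_filter, Finset.mem_univ, true_and, Finset.mem_singleton, Fin.le_def,
      Fin.lt_def, Fin.ext_iff, Fin.val_castSucc, Fin.val_succ]
    omega
  rw [this, Finset.sum_singleton]

lemma card_edges_between (x y : Fin (m + 1)) :
    (Finset.univ.filter fun v : Fin m => x ≤ v.castSucc ∧ v.castSucc < y).card = (y : ℕ) - x := by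
  rw [← Fin.card_Ico, ← Finset.card_map Fin.castSuccEmb]
  congr 1
  ext z
  simp only [Finset.mem_map, Finset.mem_filter, Finset.mem_univ, true_and, Finset.mem_Ico]
  constructor
  · rintro ⟨v, hv, rfl⟩
    exact hv
  · rintro ⟨h1, h2⟩
    have h3 : (z : ℕ) < m := by
      have := y.isLt
      have : (z : ℕ) < y := h2
      omega
    exact ⟨⟨z, h3⟩, ⟨h1, h2⟩, rfl⟩

/-- Recentring by the midpoint tail sums makes the two one-sided conditions a single absolute value.
The constant `k` absorbs the contribution of the other coordinates on a line of the grid. -/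
lemma zero_lt_violationScore_iff {l u : Fin m → ℝ} {f φ : Fin (m + 1) → ℝ} {k : ℝ}
    (hw : ∀ t, 0 < halfWidth l u t)
    (hφ : ∀ t, φ t = f t + tailSum (fun v => (u v + l v) / 2) t + k) {x y : Fin (m + 1)}
    (h : x < y) :
    0 < violationScore l u f x y ↔
      |-tailSum (halfWidth l u) x - -tailSum (halfWidth l u) y| < |φ x - φ y| := by
  have e0 : ∀ F : Fin m → ℝ,
      ∑ v : Fin m with y ≤ v.castSucc ∧ v.castSucc < x, F v = 0 := fun F => by
    rw [Finset.filter_false_of_mem, Finset.sum_empty]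
    rintro v - ⟨h1, h2⟩
    exact absurd (h1.trans_lt h2) h.not_gt
  have e1 := tailSum_sub_tailSum (fun v => (u v + l v) / 2) h.le
  have e2 := tailSum_sub_tailSum (halfWidth l u) h.le
  have h3 : 0 ≤ tailSum (halfWidth l u) x - tailSum (halfWidth l u) y := by
    rw [e2]
    exact Finset.sum_nonneg fun v _ => (hw v).le
  simp only [halfWidth, add_div, sub_div, Finset.sum_add_distrib, Finset.sum_sub_distrib,
    ← Finset.sum_div] at e1 e2
  rw [abs_sub_comm (-tailSum (halfWidth l u) x)]
  rw [show -tailSum (halfWidth l u) y - -tailSum (halfWidth l u) x =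
    tailSum (halfWidth l u) x - tailSum (halfWidth l u) y by ring, abs_of_nonneg h3]
  simp only [violationScore, quasimetric, e0, lt_max_iff, lt_abs, hφ, add_div]
  simp only [halfWidth, sub_div] at *
  constructor
  · rintro (h4 | h4)
    · left; linarith
    · right; linarith
  · rintro (h4 | h4)
    · left; linarith
    · right; linarith

/-- The product form also covers the case without query pairs, where both sides vanish. -/
lemma lineTester_toReal_mul_card (r : ℝ) (l u : Fin m → ℝ) (f : Fin (m + 1) → ℝ) :
    (lineTester r l u f true).toReal * (queryPairs r l u).card =
      ((queryPairs r l u).filter fun p => 0 < violationScore l u f p.1 p.2).card := by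
  classical
  by_cases h : (queryPairs r l u).Nonempty
  · have hne : ((queryPairs r l u).card : ℝ) ≠ 0 := by
      exact_mod_cast h.card_pos.ne'
    rw [lineTester, dif_pos h, PMF.map_apply, tsum_fintype]
    rw [Finset.sum_congr rfl (g := fun p =>
        if p ∈ (queryPairs r l u).filter fun p => 0 < violationScore l u f p.1 p.2 then
          ((queryPairs r l u).card : ENNReal)⁻¹ else 0) fun p _ => by
      rw [PMF.uniformOfFinset_apply]
      by_cases h1 : 0 < violationScore l u f p.1 p.2 <;>
        by_cases h2 : p ∈ queryPairs r l u <;> simp [h1, h2]]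
    rw [Finset.sum_ite_mem, Finset.univ_inter, Finset.sum_const, nsmul_eq_mul, ENNReal.toReal_mul,
      ENNReal.toReal_inv, ENNReal.toReal_natCast, ENNReal.toReal_natCast, mul_assoc,
      inv_mul_cancel₀ hne, mul_one]
  · rw [Finset.not_nonempty_iff_eq_empty.1 h]
    simp

lemma card_queryPairs_le {r : ℝ} (l u : Fin m → ℝ) (hD : 0 ≤ r / ⨅ t, halfWidth l u t) :
    ((queryPairs r l u).card : ℝ) ≤ (m + 1) * min (r / ⨅ t, halfWidth l u t) (m + 1) := by
  classical
  set D := r / ⨅ t, halfWidth l u t with hDdef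
  have h1 : (queryPairs r l u).card ≤ ∑ x : Fin (m + 1), min ⌊D⌋₊ (m + 1) := by
    rw [queryPairs, Finset.card_filter, Fintype.sum_prod_type]
    refine Finset.sum_le_sum fun x _ => ?_
    rw [← Finset.card_filter, le_min_iff]
    constructor
    · calc _ ≤ (Finset.Ioc (x : ℕ) (x + ⌊D⌋₊)).card := by
            refine Finset.card_le_card_of_injOn (fun y => (y : ℕ)) (fun y hy => ?_)
              fun _ _ _ _ h => Fin.ext h
            simp only [Finset.coe_filter, Finset.mem_univ, true_and, Set.mem_ofPred_eq] at hy
            obtain ⟨h1, h2⟩ := hy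
            have h3 : (x : ℕ) < y := h1
            rw [← hDdef, ← Nat.cast_sub h3.le] at h2
            have h4 := Nat.le_floor h2
            simp only [Finset.coe_Ioc, Set.mem_Ioc]
            omega
        _ = ⌊D⌋₊ := by simp
    · exact (Finset.card_le_univ _).trans_eq (Fintype.card_fin _)
  rw [Finset.sum_const, Finset.card_univ, Fintype.card_fin, smul_eq_mul] at h1
  calc ((queryPairs r l u).card : ℝ) ≤ (((m + 1) * min ⌊D⌋₊ (m + 1) : ℕ) : ℝ) := by exact_mod_cast h1
    _ ≤ _ := by
        push_cast
        gcongr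
        exact Nat.floor_le hD

/-- The rejection probability of the line tester bounds the `L₁`-distance. -/
lemma exists_near_of_lineTester [NeZero m] {l u : Fin m → ℝ} (hlu : ∀ t, l t < u t) {C : ℝ}
    (hC : ∀ s t, halfWidth l u s / halfWidth l u t ≤ C) {r : ℝ} (hr : 0 < r)
    {f φ : Fin (m + 1) → ℝ} {k : ℝ}
    (hφ : ∀ t, φ t = f t + tailSum (fun v => (u v + l v) / 2) t + k)
    (hφr : ∀ x y, |φ x - φ y| ≤ r) :
    ∃ η : Fin (m + 1) → ℝ, (∀ t : Fin m, |η t.succ - η t.castSucc| ≤ halfWidth l u t) ∧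
      ∑ x, |φ x - η x| ≤ 4 * C * r * (m + 1) * (lineTester r l u f true).toReal := by
  classical
  have hw : ∀ t, 0 < halfWidth l u t := fun t => by
    have := hlu t
    rw [halfWidth]
    linarith
  obtain ⟨t₀, ht₀⟩ := exists_eq_ciInf_of_finite (f := halfWidth l u)
  set ω := ⨅ t, halfWidth l u t with hωdef
  have hω : 0 < ω := ht₀ ▸ hw t₀
  have hωle : ∀ t, ω ≤ halfWidth l u t := fun t => ciInf_le (Set.finite_range _).bddBelow t
  have hleC : ∀ t, halfWidth l u t ≤ C * ω := fun t => by
    rw [← ht₀]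
    exact (div_le_iff₀ (hw t₀)).1 (hC t t₀)
  have hC1 : 1 ≤ C := by simpa [(hw t₀).ne'] using hC t₀ t₀
  -- `(m + 1) * μ` bounds the number of query pairs, so the `μ` in the denominator of the distance
  -- bound cancels.
  set μ := min (r / ω) (m + 1) with hμdef
  have hμ : 0 < μ := lt_min (by positivity) (by positivity)
  have hμr : μ * ω ≤ r := (le_div_iff₀ hω).1 (min_le_left _ _)
  set U : Fin (m + 1) → ℝ := fun x => -tailSum (halfWidth l u) x with hUdef
  have hUsub : ∀ x y : Fin (m + 1), x ≤ y →
      U y - U x = ∑ v : Fin m with x ≤ v.castSucc ∧ v.castSucc < y, halfWidth l u v := by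
    intro x y h
    rw [← tailSum_sub_tailSum _ h]
    simp only [hUdef]
    ring
  have hcast : ∀ x y : Fin (m + 1), x ≤ y →
      (((y : ℕ) - (x : ℕ) : ℕ) : ℝ) = ((y : ℕ) : ℝ) - ((x : ℕ) : ℝ) := fun x y h =>
    Nat.cast_sub h
  have hU : Monotone U := fun x y h => by
    rw [← sub_nonneg, hUsub x y h]
    exact Finset.sum_nonneg fun v _ => (hw v).le
  have hUC : ∀ x y : Fin (m + 1), x ≤ y →
      U y - U x ≤ C * ω * (((y : ℕ) : ℝ) - ((x : ℕ) : ℝ)) := fun x y h => by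
    rw [hUsub x y h, ← hcast x y h, ← card_edges_between, mul_comm, ← nsmul_eq_mul]
    exact Finset.sum_le_card_nsmul _ _ _ fun v _ => hleC v
  have hUω : ∀ x y : Fin (m + 1), x ≤ y →
      ω * (((y : ℕ) : ℝ) - ((x : ℕ) : ℝ)) ≤ U y - U x := fun x y h => by
    rw [hUsub x y h, ← hcast x y h, ← card_edges_between, mul_comm, ← nsmul_eq_mul]
    exact Finset.card_nsmul_le_sum _ _ _ fun v _ => hωle v
  obtain ⟨η, h1, h2⟩ := exists_lipschitz_near_of_violatedPairs hC1 hr.le hμ hμr (min_le_right _ _)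
    hω.le hφr hU hUC
  -- No violated pair is missed: violation gives `ω * (y - x) ≤ U y - U x < |φ x - φ y| ≤ r`.
  have hviol : violatedPairs φ U =
      (queryPairs r l u).filter fun p => 0 < violationScore l u f p.1 p.2 := by
    ext ⟨x, y⟩
    simp only [violatedPairs, queryPairs, Finset.mem_filter, Finset.mem_univ, true_and]
    constructor
    · rintro ⟨hxy, hv⟩
      refine ⟨⟨hxy, ?_⟩, (zero_lt_violationScore_iff hw hφ hxy).2 hv⟩
      rw [le_div_iff₀ hω, mul_comm]
      have a1 := hUω x y hxy.le
      have a2 := neg_abs_le (U x - U y)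
      linarith [hφr x y]
    · rintro ⟨⟨hxy, -⟩, hv⟩
      exact ⟨hxy, (zero_lt_violationScore_iff hw hφ hxy).1 hv⟩
  refine ⟨η, fun t => ?_, h2.trans ?_⟩
  · refine (h1 _ _).trans_eq ?_
    have := tailSum_castSucc_sub_tailSum_succ (halfWidth l u) t
    rw [show U t.succ - U t.castSucc = halfWidth l u t by simp only [hUdef]; linarith,
      abs_of_pos (hw t)]
  · rw [hviol]
    have hp := lineTester_toReal_mul_card r l u f
    have hcard := card_queryPairs_le l u (r := r) (by positivity)
    have hle := mul_le_mul_of_nonneg_left hcard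
      (ENNReal.toReal_nonneg (a := lineTester r l u f true))
    rw [hp] at hle
    calc 4 * C * r / μ * _ ≤
        4 * C * r / μ * ((lineTester r l u f true).toReal * ((m + 1) * μ)) := by
          gcongr
      _ = _ := by
          field_simp

end

/-! ### Amplification by independent repetitions. -/

noncomputable section

lemma PMF.toReal_true_add_toReal_false (p : PMF Bool) :
    (p true).toReal + (p false).toReal = 1 := by
  have h := p.tsum_coe
  rw [tsum_fintype, Fintype.sum_bool] at h
  rw [← ENNReal.toReal_add (p.apply_ne_top _) (p.apply_ne_top _), h, ENNReal.toReal_one]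

lemma repeatTest_false (p : PMF Bool) (T : ℕ) : repeatTest p T false = p false ^ T := by
  induction T with
  | zero => simp [repeatTest]
  | succ T ih =>
    rw [repeatTest, PMF.bind_apply, tsum_fintype, Fintype.sum_bool]
    simp [ih, pow_succ']

/-- If one run rejects with probability at least `q`, then `T ≥ 2 / q` independent runs reject with
probability at least `2 / 3`. -/
lemma two_thirds_le_repeatTest {p : PMF Bool} {q : ℝ} (hq : q ≤ (p true).toReal) {T : ℕ}
    (hT : 2 ≤ q * T) : (2 : ℝ) / 3 ≤ (repeatTest p T true).toReal := by
  have h1 := (repeatTest p T).toReal_true_add_toReal_false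
  have h2 := p.toReal_true_add_toReal_false
  rw [repeatTest_false, ENNReal.toReal_pow] at h1
  have h3 : (p false).toReal ^ T ≤ Real.exp (-(q * T)) := by
    calc (p false).toReal ^ T ≤ Real.exp (-q) ^ T := by
          gcongr
          linarith [Real.add_one_le_exp (-q)]
      _ = _ := by rw [← Real.exp_nat_mul]; ring_nf
  have h4 : Real.exp (-(q * T)) ≤ 1 / 3 := by
    calc Real.exp (-(q * T)) ≤ Real.exp (-2) := Real.exp_le_exp.2 (by linarith)
      _ ≤ 1 / 3 := by
        rw [Real.exp_neg, inv_eq_one_div]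
        exact one_div_le_one_div_of_le (by norm_num) (by linarith [Real.add_one_le_exp 2])
  linarith

/-! ### Decomposition into lines and assembly of the bounds. -/

variable {m d : ℕ}

lemma AxisLine.point_self (ℓ : AxisLine m d) (t : Fin (m + 1)) : ℓ.point t ℓ.1 = t := by
  simp [AxisLine.point]

lemma AxisLine.point_of_ne (ℓ : AxisLine m d) (t : Fin (m + 1)) {j : Fin d} (h : j ≠ ℓ.1) :
    ℓ.point t j = ℓ.2 ⟨j, h⟩ := by
  simp [AxisLine.point, h]

lemma sum_eq_sum_lines (i : Fin d) (F : Hypergrid m d → ℝ) :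
    ∑ x, F x = ∑ y : {j : Fin d // j ≠ i} → Fin (m + 1), ∑ t,
      F (AxisLine.point (⟨i, y⟩ : AxisLine m d) t) := by
  rw [← (Equiv.funSplitAt i (Fin (m + 1))).symm.sum_comp F, Fintype.sum_prod_type, Finset.sum_comm]
  refine Finset.sum_congr rfl fun y _ => Finset.sum_congr rfl fun t _ => congrArg F ?_
  funext j
  by_cases h : j = i <;> simp [AxisLine.point, Equiv.funSplitAt, Equiv.piSplitAt, h]

lemma card_axisLine_mul : (Fintype.card (AxisLine m d) : ℝ) * (m + 1) =
    d * Fintype.card (Hypergrid m d) := by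
  have h : ∀ i : Fin d, (Fintype.card (Hypergrid m d) : ℝ) =
      Fintype.card ({j : Fin d // j ≠ i} → Fin (m + 1)) * (m + 1) := fun i => by
    have := sum_eq_sum_lines i fun _ : Hypergrid m d => (1 : ℝ)
    simpa only [Finset.sum_const, Finset.card_univ, nsmul_eq_mul, mul_one, Fintype.card_fin,
      Nat.cast_add, Nat.cast_one] using this
  rw [Fintype.card_sigma, Nat.cast_sum, Finset.sum_mul, Finset.sum_congr rfl fun i _ => (h i).symm]
  simp

/-- The distribution on outputs of a single run of the hypergrid tester. -/
def singleTest [NeZero d] (r : ℝ) (l u : Fin d → Fin m → ℝ) (f : Hypergrid m d → ℝ) : PMF Bool :=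
  (PMF.uniformOfFintype (AxisLine m d)).bind fun ℓ =>
    lineTester r (l ℓ.1) (u ℓ.1) fun t => f (ℓ.point t)

lemma card_mul_singleTest [NeZero d] (r : ℝ) (l u : Fin d → Fin m → ℝ) (f : Hypergrid m d → ℝ) :
    (Fintype.card (AxisLine m d) : ℝ) * (singleTest r l u f true).toReal =
      ∑ ℓ : AxisLine m d, (lineTester r (l ℓ.1) (u ℓ.1) (fun t => f (ℓ.point t)) true).toReal := by
  rw [singleTest, PMF.bind_apply, tsum_fintype]
  simp only [PMF.uniformOfFintype_apply]
  rw [← Finset.mul_sum, ENNReal.toReal_mul, ENNReal.toReal_inv, ENNReal.toReal_natCast,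
    ENNReal.toReal_sum fun _ _ => PMF.apply_ne_top _ _, ← mul_assoc,
    mul_inv_cancel₀ (by exact_mod_cast Fintype.card_ne_zero), one_mul]

lemma symmetrize_point (l u : Fin d → Fin m → ℝ) (f : Hypergrid m d → ℝ) (ℓ : AxisLine m d) :
    ∃ k, ∀ t, symmetrize l u f (ℓ.point t) =
      f (ℓ.point t) + tailSum (fun v => (u ℓ.1 v + l ℓ.1 v) / 2) t + k := by
  refine ⟨∑ j ∈ Finset.univ.erase ℓ.1, tailSum (fun v => (u j v + l j v) / 2) (ℓ.point 0 j),
    fun t => ?_⟩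
  have h : symmetrize l u f (ℓ.point t) =
      f (ℓ.point t) + ∑ j, tailSum (fun v => (u j v + l j v) / 2) (ℓ.point t j) := rfl
  rw [h, ← Finset.add_sum_erase _ _ (Finset.mem_univ ℓ.1), ℓ.point_self, ← add_assoc]
  congr 1
  refine Finset.sum_congr rfl fun j hj => ?_
  rw [ℓ.point_of_ne _ (Finset.ne_of_mem_erase hj), ℓ.point_of_ne _ (Finset.ne_of_mem_erase hj)]

lemma symmetrize_update_succ_sub (l u : Fin d → Fin m → ℝ) (f : Hypergrid m d → ℝ) (i : Fin d)
    (x : Hypergrid m d) (t : Fin m) (hx : x i = t.castSucc) :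
    symmetrize l u f (Function.update x i t.succ) - symmetrize l u f x =
      f (Function.update x i t.succ) - f x - (u i t + l i t) / 2 := by
  have h : ∀ x, symmetrize l u f x =
      f x + ∑ j, tailSum (fun v => (u j v + l j v) / 2) (x j) := fun _ => rfl
  have h1 := tailSum_castSucc_sub_tailSum_succ (fun v => (u i v + l i v) / 2) t
  rw [h, h, ← Finset.add_sum_erase _ _ (Finset.mem_univ i),
    ← Finset.add_sum_erase _ (fun j => tailSum _ (x j)) (Finset.mem_univ i),
    Finset.sum_congr rfl (g := fun j => tailSum (fun v => (u j v + l j v) / 2) (x j)) fun j hj => by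
      rw [Function.update_of_ne (Finset.ne_of_mem_erase hj)], Function.update_self, hx]
  linarith

/-- Functions near the symmetrization with symmetric bounds yield functions near `f` in the
property. -/
lemma exists_derivativeBounded (l u : Fin d → Fin m → ℝ) (f g : Hypergrid m d → ℝ)
    (hg : ∀ i, g ∈ BoundedAlong (halfWidth (l i) (u i)) i) :
    ∃ h ∈ DerivativeBounded l u, ∀ x, f x - h x = symmetrize l u f x - g x := by
  -- Symmetrization is translation by a function independent of `f`; undoing it on `g` preserves
  -- differences.
  refine ⟨fun x => f x - (symmetrize l u f x - g x), fun i x t hx => ?_, fun x => by ring⟩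
  have h1 := abs_le.1 (hg i x t hx)
  have h2 := symmetrize_update_succ_sub l u f i x t hx
  rw [halfWidth] at h1
  constructor <;> linarith

/-- The rejection probability of a single run bounds the `L₁`-distance to the property. -/
lemma exists_near_of_singleTest [NeZero m] [NeZero d] {l u : Fin d → Fin m → ℝ}
    (hlu : IsBoundingFamily l u) {C : ℝ}
    (hC : ∀ i s t, halfWidth (l i) (u i) s / halfWidth (l i) (u i) t ≤ C) {a b : ℝ} (hab : a < b)
    {f : Hypergrid m d → ℝ} (hf : ∀ x, symmetrize l u f x ∈ Set.Icc a b) :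
    ∃ h ∈ DerivativeBounded l u, l1Dist (b - a) f h ≤
      8 * C * d * (singleTest (b - a) l u f true).toReal := by
  have hr : 0 < b - a := sub_pos.2 hab
  set r := b - a with hrdef
  have hline : ∀ ℓ : AxisLine m d, ∃ η : Fin (m + 1) → ℝ,
      (∀ t : Fin m, |η t.succ - η t.castSucc| ≤ halfWidth (l ℓ.1) (u ℓ.1) t) ∧
      ∑ t, |symmetrize l u f (ℓ.point t) - η t| ≤ 4 * C * r * (m + 1) *
        (lineTester r (l ℓ.1) (u ℓ.1) (fun t => f (ℓ.point t)) true).toReal := fun ℓ => by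
    obtain ⟨k, hk⟩ := symmetrize_point l u f ℓ
    refine exists_near_of_lineTester (hlu ℓ.1) (hC ℓ.1) hr hk fun x y => ?_
    have h1 := hf (ℓ.point x)
    have h2 := hf (ℓ.point y)
    rw [abs_le]
    constructor <;> linarith [h1.1, h1.2, h2.1, h2.2]
  choose η hη1 hη2 using hline
  -- For each `i`, the line approximations in direction `i` glue to one function bounded along `i`,
  -- at a cost summed over these lines.
  obtain ⟨g, hg1, hg2⟩ := exists_forall_boundedAlong_near (w := fun i => halfWidth (l i) (u i))
    (fun i t => by have := hlu i t; rw [halfWidth]; linarith) (symmetrize l u f)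
    (fun i x => η ⟨i, fun j => x j⟩ (x i))
    (fun i => ∑ y, 4 * C * r * (m + 1) * (lineTester r (l i) (u i)
      (fun t => f (AxisLine.point (⟨i, y⟩ : AxisLine m d) t)) true).toReal)
    (fun i x t hx => by
      have : (fun j : {j // j ≠ i} => Function.update x i t.succ j) =
          fun j : {j // j ≠ i} => x j :=
        funext fun j => Function.update_of_ne j.2 _ _
      simp only [this, Function.update_self, hx]
      exact hη1 _ t)
    (fun i => by
      rw [sum_eq_sum_lines i]
      refine Finset.sum_le_sum fun y _ => le_trans (le_of_eq ?_) (hη2 ⟨i, y⟩)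
      refine Finset.sum_congr rfl fun t _ => ?_
      have e1 : (fun j : {j // j ≠ i} => AxisLine.point (⟨i, y⟩ : AxisLine m d) t j) = y :=
        funext fun j => AxisLine.point_of_ne ⟨i, y⟩ t j.2
      have e2 : AxisLine.point (⟨i, y⟩ : AxisLine m d) t i = t := AxisLine.point_self ⟨i, y⟩ t
      rw [e1, e2])
  obtain ⟨h, hh1, hh2⟩ := exists_derivativeBounded l u f g hg1
  refine ⟨h, hh1, ?_⟩
  have hcard : (0 : ℝ) < Fintype.card (Hypergrid m d) := by exact_mod_cast Fintype.card_pos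
  simp only [← Finset.mul_sum] at hg2
  have hsum := card_mul_singleTest r l u f
  rw [Fintype.sum_sigma] at hsum
  rw [← hsum] at hg2
  rw [l1Dist, one_div, inv_mul_le_iff₀ hr, div_le_iff₀ hcard]
  simp only [hh2]
  refine hg2.trans_eq ?_
  linear_combination
    8 * C * r * (singleTest r l u f true).toReal * card_axisLine_mul (m := m) (d := d)

end
theorem mainTheorem7 :
    ∃ K : ℝ, 0 < K ∧
      ∀ (m d : ℕ) [NeZero d] (l u : Fin d → Fin m → ℝ), IsBoundingFamily l u →
      ∀ C : ℝ, (∀ (i : Fin d) (s t : Fin m),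
        halfWidth (l i) (u i) s / halfWidth (l i) (u i) t ≤ C) →
      ∀ (a b : ℝ), a < b →
      ∀ f : Hypergrid m d → ℝ, (∀ x, symmetrize l u f x ∈ Set.Icc a b) →
      ∀ ε : ℝ, 0 < ε → ε < 1 → IsFar (b - a) ε f (DerivativeBounded l u) →
        (2 : ℝ) / 3 ≤
          (hypergridTester ⌈K * C * (d : ℝ) / ε⌉₊ (b - a) l u f true).toReal := by
  -- `16 = 4 * 2 * 2`: the line bound, the dimension reduction, and `q * T ≥ 2` for amplification.
  refine ⟨16, by norm_num, ?_⟩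
  intro m d _ l u hlu C hC a b hab f hf ε hε _ hfar
  -- For `n = 1` there are no edges, so `f` itself has the property and cannot be far. Otherwise an
  -- edge exists, and with it `0 < C`.
  rcases m.eq_zero_or_pos with rfl | hm
  · have := hfar f fun i x t => t.elim0
    simp only [l1Dist, sub_self, abs_zero, Finset.sum_const_zero, zero_div, mul_zero] at this
    exact absurd this hε.not_gt
  have : NeZero m := ⟨hm.ne'⟩
  have hC0 : 0 < C := by
    have h1 := hlu 0 0
    have h2 : 0 < halfWidth (l 0) (u 0) 0 := by rw [halfWidth]; linarith
    exact (div_pos h2 h2).trans_le (hC 0 0 0)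
  have hd : (0 : ℝ) < d := by exact_mod_cast Nat.pos_of_neZero d
  obtain ⟨h, hh, hle⟩ := exists_near_of_singleTest hlu hC hab hf
  have hp := (hfar h hh).trans_le hle
  refine two_thirds_le_repeatTest (p := singleTest (b - a) l u f) (q := ε / (8 * C * d)) ?_ ?_
  · rw [div_le_iff₀ (by positivity), mul_comm]
    exact hp.le
  · calc (2 : ℝ) = ε / (8 * C * d) * (16 * C * d / ε) := by
          field_simp
          norm_num
      _ ≤ _ := by
          gcongr
          exact Nat.le_ceil _
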